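/- Let $\zeta\in\mathbb{C}$ be either square root of $\frac{-1+i\sqrt7}{2}$, and let $$\alpha=\tfrac12\zeta^3+\zeta,\qquad d(\lambda)=\operatorname{Im}\bigl(\bar\alpha\,J_0(\lambda\zeta)\,J_1(\lambda\bar\zeta)\bigr),$$ where $J_n(z)=\sum_{k\ge0}\frac{(-1)^k}{k!\,(k+n)!}(z/2)^{2k+n}$ are the Bessel functions of the first kind. Fix $\lambda>0$ with $d(\lambda)J_1(\lambda)\neq0$. Consider the system $$\begin{aligned} r^2A''(r)+rA'(r)-A(r)+\lambda^2r^2A(r)+2\lambda r^2C'(r)&=0,\\ r^2B''(r)+rB'(r)-B(r)+\lambda^2r^2B(r)&=0,\\ C'(r)+rC''(r)+2\lambda^2rC(r)+2\lambda rA'(r)+2\lambda A(r)&=0 \end{aligned}$$ for real-valued functions, with the boundary conditions $$A(0)=B(0)=C'(0)=0,\qquad A(1)=B(1)=0,\qquad C(1)=1.$$ Then the real-valued functions $$A_\lambda(r)=\frac{\sqrt2}{d(\lambda)}\operatorname{Im}\bigl(J_1(\lambda\bar\zeta)J_1(\lambda\zeta r)\bigr),\qquad B_\lambda(r)=0,\qquad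 C_\lambda(r)=\frac1{d(\lambda)}\operatorname{Im}\bigl(\bar\alpha J_1(\lambda\bar\zeta)J_0(\lambda\zeta r)\bigr)$$ are infinitely differentiable, are the same for both choices of $\zeta$, and form the unique solution of this boundary value problem. More precisely, for every interval $I$ with $[0,1]\subseteq I\subseteq[0,\infty)$, $(A_\lambda,B_\lambda,C_\lambda)$ is a solution on $I$, and any solution $(A,B,C)$ on $I$ coincides with it on $I$. Here a solution on $I$ consists of functions that are continuous on $I$ and twice differentiable in the interior of $I$, satisfy the system there and satisfy the boundary conditions ($C'(0)$ being the one-sided derivative). -/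

import Mathlib

noncomputable section

namespace RadialSystem

open scoped Nat

/-- The Bessel function of the first kind `J_n` of integer order `n ≥ 0`, by its power series
(which converges at every complex number). -/
def besselJ (n : ℕ) (z : ℂ) : ℂ :=
  ∑' k : ℕ, (-1 : ℂ) ^ k / ((k ! : ℂ) * ((k + n)! : ℂ)) * (z / 2) ^ (2 * k + n)

theorem summable_besselJ (n : ℕ) (z : ℂ) :
    Summable fun k : ℕ =>
      (-1 : ℂ) ^ k / ((k ! : ℂ) * ((k + n)! : ℂ)) * (z / 2) ^ (2 * k + n) := by
  have h := (Real.summable_pow_div_factorial (‖z / 2‖ ^ 2)).mul_left (‖z / 2‖ ^ n)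
  refine Summable.of_norm_bounded h fun k => ?_
  rw [norm_mul, norm_div, norm_pow, norm_neg, norm_one, one_pow, norm_mul, norm_pow,
    Complex.norm_natCast, Complex.norm_natCast, pow_add, pow_mul]
  have h1 : (1 : ℝ) ≤ ((k + n)! : ℝ) := by exact_mod_cast Nat.factorial_pos _
  have h0 : (0 : ℝ) < (k ! : ℝ) := by exact_mod_cast Nat.factorial_pos _
  have h2 : 1 / ((k ! : ℝ) * ((k + n)! : ℝ)) ≤ 1 / (k ! : ℝ) :=
    one_div_le_one_div_of_le h0 (le_mul_of_one_le_right h0.le h1)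
  calc 1 / ((k ! : ℝ) * ((k + n)! : ℝ)) * ((‖z / 2‖ ^ 2) ^ k * ‖z / 2‖ ^ n)
      ≤ 1 / (k ! : ℝ) * ((‖z / 2‖ ^ 2) ^ k * ‖z / 2‖ ^ n) := by gcongr
    _ = ‖z / 2‖ ^ n * ((‖z / 2‖ ^ 2) ^ k / (k ! : ℝ)) := by ring

/-- `α = ζ³ / 2 + ζ`. -/
def alpha (ζ : ℂ) : ℂ := ζ ^ 3 / 2 + ζ

/-- `d(λ) = Im (ᾱ J₀(λ ζ) J₁(λ ζ̄))`. -/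
def d (ζ : ℂ) (lam : ℝ) : ℝ :=
  (starRingEnd ℂ (alpha ζ) * besselJ 0 (lam * ζ) * besselJ 1 (lam * starRingEnd ℂ ζ)).im

/-- `A_λ(r) = (√2 / d(λ)) Im (J₁(λ ζ̄) J₁(λ ζ r))`. -/
def solA (ζ : ℂ) (lam : ℝ) (r : ℝ) : ℝ :=
  √2 / d ζ lam * (besselJ 1 (lam * starRingEnd ℂ ζ) * besselJ 1 (lam * ζ * r)).im

/-- `C_λ(r) = (1 / d(λ)) Im (ᾱ J₁(λ ζ̄) J₀(λ ζ r))`. -/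
def solC (ζ : ℂ) (lam : ℝ) (r : ℝ) : ℝ :=
  1 / d ζ lam *
    (starRingEnd ℂ (alpha ζ) * besselJ 1 (lam * starRingEnd ℂ ζ) * besselJ 0 (lam * ζ * r)).im

/-- Existence of the second derivative of `f` at `r`, so that `deriv f r` and
`deriv (deriv f) r` are the actual derivatives. -/
def TwiceDifferentiableAt (f : ℝ → ℝ) (r : ℝ) : Prop :=
  (∀ᶠ s in nhds r, DifferentiableAt ℝ f s) ∧ DifferentiableAt ℝ (deriv f) r

/-- `A, B, C` solve the radial boundary value problem with parameter `lam` on the interval `I`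
(used for intervals with `[0, 1] ⊆ I ⊆ [0, ∞)`): they are continuous on `I`, twice differentiable
in its interior, satisfy the differential system there and take the boundary values. -/
structure IsSolution (lam : ℝ) (I : Set ℝ) (A B C : ℝ → ℝ) : Prop where
  continuousOn_A : ContinuousOn A I
  continuousOn_B : ContinuousOn B I
  continuousOn_C : ContinuousOn C I
  twiceDiff_A : ∀ r ∈ interior I, TwiceDifferentiableAt A r
  twiceDiff_B : ∀ r ∈ interior I, TwiceDifferentiableAt B r
  twiceDiff_C : ∀ r ∈ interior I, TwiceDifferentiableAt C r
  eq_A : ∀ r ∈ interior I,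
    r ^ 2 * deriv (deriv A) r + r * deriv A r - A r + lam ^ 2 * r ^ 2 * A r
      + 2 * lam * r ^ 2 * deriv C r = 0
  eq_B : ∀ r ∈ interior I,
    r ^ 2 * deriv (deriv B) r + r * deriv B r - B r + lam ^ 2 * r ^ 2 * B r = 0
  eq_C : ∀ r ∈ interior I,
    deriv C r + r * deriv (deriv C) r + 2 * lam ^ 2 * r * C r
      + 2 * lam * r * deriv A r + 2 * lam * A r = 0
  A_zero : A 0 = 0
  B_zero : B 0 = 0
  deriv_C_zero : HasDerivWithinAt C 0 I 0
  A_one : A 1 = 0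
  B_one : B 1 = 0
  C_one : C 1 = 1

end RadialSystem

end

/-!
With complex coefficients, `A = a J₁(μ r)`, `C = b J₀(μ r)` solves the coupled equations if
`(λ² - μ²) a = 2 λ μ b` and `(2 λ² - μ²) b + 2 λ μ a = 0`. For `μ = λ ζ` these two conditions
are compatible because `(1 - ζ²) (2 - ζ²) + 4 ζ² = ζ⁴ + ζ² + 2 = 0`, and `(a, b)` is a multiple
of `(√2, ᾱ)`. Imaginary parts of complex multiples of this solution form a real plane of regular
solutions, which contains `(A_λ, C_λ)`.

For uniqueness, Lagrange's identity says that `r ω` is constant for an alternating form `ω` in the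
Cauchy data of two solutions. The constant is `0` when one solution is `C¹` at `0` and the other
merely continuous there. The Cauchy data of the regular solutions form a maximal `ω`-isotropic
plane, so every solution that is continuous at `0` belongs to the plane of regular solutions, and
`d(λ) ≠ 0` says exactly that a member of this plane is determined by its values at `1`. The
equation for `B` is the same system with the coupling turned off, and there `J₁(λ)` plays the role
of `d(λ)`.
-/

namespace RadialSystem

open Filter Topology Set

section LinearODE

theorem eqOn_of_hasDerivAt_clm {E : Type*} [NormedAddCommGroup E] [NormedSpace ℝ E]
    {L : ℝ → E →L[ℝ] E} {y z : ℝ → E} {S : Set ℝ} {s : ℝ} (hS : S.OrdConnected)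
    (hL : ContinuousOn L S) (hy : ∀ r ∈ S, HasDerivAt y (L r (y r)) r)
    (hz : ∀ r ∈ S, HasDerivAt z (L r (z r)) r) (hs : s ∈ S) (hyz : y s = z s) : EqOn y z S := by
  intro r hr
  have hsub : uIcc s r ⊆ S := hS.uIcc_subset hs hr
  obtain ⟨K, hK⟩ := isCompact_uIcc.exists_bound_of_continuousOn (hL.mono hsub)
  have lipschitz (t : ℝ) (ht : t ∈ uIcc s r) : LipschitzOnWith K.toNNReal (L t) univ :=
    ((L t).lipschitz.weaken (NNReal.le_toNNReal_of_coe_le (hK t ht))).lipschitzOnWith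
  have continuousOn {x : ℝ → E} (hx : ∀ t ∈ S, HasDerivAt x (L t (x t)) t) :
      ContinuousOn x (uIcc s r) :=
    fun t ht => (hx t (hsub ht)).continuousAt.continuousWithinAt
  rcases le_total s r with hsr | hrs
  · rw [uIcc_of_le hsr] at hsub lipschitz continuousOn
    exact ODE_solution_unique_of_mem_Icc_right
      (fun t ht => lipschitz t (Ico_subset_Icc_self ht))
      (continuousOn hy) (fun t ht => (hy t (hsub (Ico_subset_Icc_self ht))).hasDerivWithinAt)
      (fun _ _ => mem_univ _)
      (continuousOn hz) (fun t ht => (hz t (hsub (Ico_subset_Icc_self ht))).hasDerivWithinAt)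
      (fun _ _ => mem_univ _) hyz (right_mem_Icc.2 hsr)
  · rw [uIcc_of_ge hrs] at hsub lipschitz continuousOn
    exact ODE_solution_unique_of_mem_Icc_left
      (fun t ht => lipschitz t (Ioc_subset_Icc_self ht))
      (continuousOn hy) (fun t ht => (hy t (hsub (Ioc_subset_Icc_self ht))).hasDerivWithinAt)
      (fun _ _ => mem_univ _)
      (continuousOn hz) (fun t ht => (hz t (hsub (Ioc_subset_Icc_self ht))).hasDerivWithinAt)
      (fun _ _ => mem_univ _) hyz (left_mem_Icc.2 hrs)

open scoped Matrix in
theorem eqOn_of_hasDerivAt_mulVec {ι : Type*} [Fintype ι] {M : ℝ → Matrix ι ι ℝ}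
    {y z : ℝ → ι → ℝ} {S : Set ℝ} {s : ℝ} (hS : S.OrdConnected) (hM : ContinuousOn M S)
    (hy : ∀ r ∈ S, HasDerivAt y (M r *ᵥ y r) r) (hz : ∀ r ∈ S, HasDerivAt z (M r *ᵥ z r) r)
    (hs : s ∈ S) (hyz : y s = z s) : EqOn y z S := by
  classical
  let toCLM : Matrix ι ι ℝ →ₗ[ℝ] (ι → ℝ) →L[ℝ] ι → ℝ :=
    LinearMap.toContinuousLinearMap.toLinearMap ∘ₗ Matrix.toLin'.toLinearMap
  exact eqOn_of_hasDerivAt_clm hS (L := fun r => toCLM (M r))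
    (toCLM.continuous_of_finiteDimensional.comp_continuousOn hM) hy hz hs hyz

/-- `((x - a) F(x))' = F(x) + (x - a) F'(x)` tends to `c + w`, whereas the difference quotient of
`(x - a) F(x)` at `a` is `F(x)` itself. -/
theorem eq_zero_of_tendsto_sub_mul_deriv {F F' : ℝ → ℝ} {a c w : ℝ}
    (hF : Tendsto F (𝓝[>] a) (𝓝 c)) (hF' : ∀ᶠ x in 𝓝[>] a, HasDerivAt F (F' x) x)
    (hw : Tendsto (fun x => (x - a) * F' x) (𝓝[>] a) (𝓝 w)) : w = 0 := by
  have hderiv : ∀ᶠ x in 𝓝[>] a, HasDerivAt (fun x => (x - a) * F x) (F x + (x - a) * F' x) x := by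
    filter_upwards [hF'] with x hx
    simpa using ((hasDerivAt_id x).sub_const a).fun_mul hx
  have hcont : Tendsto (fun x => (x - a) * F x) (𝓝[>] a) (𝓝 0) := by
    simpa using ((tendsto_id.mono_left nhdsWithin_le_nhds).sub_const a).mul hF
  have hright : HasDerivWithinAt (fun x => (x - a) * F x) (c + w) (Ici a) a := by
    refine hasDerivWithinAt_Ici_of_tendsto_deriv
      (s := {x | HasDerivAt (fun x => (x - a) * F x) (F x + (x - a) * F' x) x} ∩ Ioi a)
      (fun x hx => hx.1.differentiableAt.differentiableWithinAt) ?_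
      (inter_mem hderiv self_mem_nhdsWithin)
      ((hF.add hw).congr' (hderiv.mono fun x hx => hx.deriv.symm))
    simpa [ContinuousWithinAt] using hcont.mono_left (nhdsWithin_mono _ inter_subset_right)
  have hslope := (hasDerivWithinAt_iff_tendsto_slope' self_notMem_Ioi).1 hright.Ioi_of_Ici
  have : c = c + w := tendsto_nhds_unique hF (hslope.congr' ?_)
  · simpa using this
  · filter_upwards [self_mem_nhdsWithin] with x hx
    simp [slope, sub_ne_zero.2 (mem_Ioi.1 hx).ne']

end LinearODE

section RadialODE

open scoped Matrix

variable {p q κ : ℝ}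

/-- The coefficient matrix, on `r ≠ 0`, of the first-order form in `(A, A', C, C')` of
`r² A'' + r A' - A + p r² A + 2 κ r² C' = 0`, `C' + r C'' + q r C + 2 κ r A' + 2 κ A = 0`. -/
noncomputable def radialMatrix (p q κ r : ℝ) : Matrix (Fin 4) (Fin 4) ℝ :=
  !![0, 1, 0, 0;
    r⁻¹ ^ 2 - p, -r⁻¹, 0, -(2 * κ);
    0, 0, 0, 1;
    -(2 * κ * r⁻¹), -(2 * κ), -q, -r⁻¹]

/-- The values `(A, A', C, C')`, which turn a pair of functions with second-order equations into a
first-order trajectory in `ℝ⁴`. -/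
noncomputable def cauchyData (A C : ℝ → ℝ) (r : ℝ) : Fin 4 → ℝ :=
  ![A r, deriv A r, C r, deriv C r]

/-- The alternating form on Cauchy data for which the radial system satisfies Lagrange's identity:
`r` times the form of two solutions is constant. -/
def lagrangeForm (κ : ℝ) (y z : Fin 4 → ℝ) : ℝ :=
  y 0 * z 1 - y 1 * z 0 - (y 2 * z 3 - y 3 * z 2) + 2 * κ * (y 0 * z 2 - y 2 * z 0)

theorem continuousOn_radialMatrix {S : Set ℝ} (hS : S ⊆ Ioi 0) :
    ContinuousOn (radialMatrix p q κ) S := by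
  have hinv : ContinuousOn (fun r : ℝ => r⁻¹) S :=
    continuousOn_inv₀.mono fun r hr => (mem_Ioi.1 (hS hr)).ne'
  refine continuousOn_pi.2 fun i => continuousOn_pi.2 fun j => ?_
  fin_cases i <;> fin_cases j <;> simp only [radialMatrix, Fin.reduceFinMk, Matrix.of_apply,
    Matrix.cons_val] <;> fun_prop

theorem hasDerivAt_radialMatrix_iff {y : ℝ → Fin 4 → ℝ} {r : ℝ} :
    HasDerivAt y (radialMatrix p q κ r *ᵥ y r) r ↔
      HasDerivAt (fun s => y s 0) (y r 1) r ∧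
      HasDerivAt (fun s => y s 1)
        ((r⁻¹ ^ 2 - p) * y r 0 - r⁻¹ * y r 1 - 2 * κ * y r 3) r ∧
      HasDerivAt (fun s => y s 2) (y r 3) r ∧
      HasDerivAt (fun s => y s 3)
        (-(2 * κ * r⁻¹ * y r 0) - 2 * κ * y r 1 - q * y r 2 - r⁻¹ * y r 3) r := by
  simp [hasDerivAt_pi, Fin.forall_fin_succ, radialMatrix, dotProduct, Fin.sum_univ_succ,
    sub_eq_add_neg, add_assoc]

theorem hasDerivAt_mul_lagrangeForm {y z : ℝ → Fin 4 → ℝ} {r : ℝ} (hr : r ≠ 0)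
    (hy : HasDerivAt y (radialMatrix p q κ r *ᵥ y r) r)
    (hz : HasDerivAt z (radialMatrix p q κ r *ᵥ z r) r) :
    HasDerivAt (fun s => s * lagrangeForm κ (y s) (z s)) 0 r := by
  obtain ⟨y0, y1, y2, y3⟩ := hasDerivAt_radialMatrix_iff.1 hy
  obtain ⟨z0, z1, z2, z3⟩ := hasDerivAt_radialMatrix_iff.1 hz
  refine ((hasDerivAt_id r).fun_mul ((((y0.fun_mul z1).fun_sub (y1.fun_mul z0)).fun_sub
    ((y2.fun_mul z3).fun_sub (y3.fun_mul z2))).fun_add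
    (((y0.fun_mul z2).fun_sub (y2.fun_mul z0)).const_mul (2 * κ)))).congr_deriv ?_
  simp only [id]
  field_simp
  ring

/-- The derivative of `y₀ z₀ - y₂ z₂` is the form plus a function continuous at `0`, and `r` times
the form is constant. -/
theorem lagrangeForm_eq_zero {S : Set ℝ} (hS : IsOpen S) (hSc : IsPreconnected S)
    (hSpos : S ⊆ Ioi 0) (hS0 : S ∈ 𝓝[>] 0) {y z : ℝ → Fin 4 → ℝ}
    (hy : ∀ r ∈ S, HasDerivAt y (radialMatrix p q κ r *ᵥ y r) r)
    (hz : ∀ r ∈ S, HasDerivAt z (radialMatrix p q κ r *ᵥ z r) r)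
    (hy_reg : ContinuousWithinAt y (Ioi 0) 0)
    (hz0 : ContinuousWithinAt (fun r => z r 0) (Ioi 0) 0)
    (hz2 : ContinuousWithinAt (fun r => z r 2) (Ioi 0) 0) {r : ℝ} (hr : r ∈ S) :
    lagrangeForm κ (y r) (z r) = 0 := by
  have hderiv (s : ℝ) (hs : s ∈ S) :=
    hasDerivAt_mul_lagrangeForm (mem_Ioi.1 (hSpos hs)).ne' (hy s hs) (hz s hs)
  have hconst : ∀ s ∈ S, s * lagrangeForm κ (y s) (z s) = r * lagrangeForm κ (y r) (z r) :=
    fun s hs => hS.is_const_of_deriv_eq_zero hSc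
      (fun t ht => (hderiv t ht).differentiableAt.differentiableWithinAt)
      (fun t ht => (hderiv t ht).deriv) hs hr
  have hy_coord (i : Fin 4) : ContinuousWithinAt (fun s => y s i) (Ioi 0) 0 :=
    continuousWithinAt_pi.1 hy_reg i
  let regular (s : ℝ) : ℝ :=
    2 * (y s 1 * z s 0 - y s 3 * z s 2) - 2 * κ * (y s 0 * z s 2 - y s 2 * z s 0)
  have hregular : ContinuousWithinAt regular (Ioi 0) 0 := by
    have := hy_coord
    fun_prop
  suffices r * lagrangeForm κ (y r) (z r) = 0 from
    (mul_eq_zero.1 this).resolve_left (mem_Ioi.1 (hSpos hr)).ne'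
  refine eq_zero_of_tendsto_sub_mul_deriv (F := fun s => y s 0 * z s 0 - y s 2 * z s 2)
    (F' := fun s => lagrangeForm κ (y s) (z s) + regular s)
    (((hy_coord 0).mul hz0).sub ((hy_coord 2).mul hz2)) ?_ ?_
  · filter_upwards [hS0] with s hs
    obtain ⟨y0, -, y2, -⟩ := hasDerivAt_radialMatrix_iff.1 (hy s hs)
    obtain ⟨z0, -, z2, -⟩ := hasDerivAt_radialMatrix_iff.1 (hz s hs)
    refine ((y0.fun_mul z0).fun_sub (y2.fun_mul z2)).congr_deriv ?_
    simp only [regular, lagrangeForm]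
    ring
  · have hlim : ContinuousWithinAt
        (fun s => r * lagrangeForm κ (y r) (z r) + s * regular s) (Ioi 0) 0 :=
      continuousWithinAt_const.add (continuousWithinAt_id.mul hregular)
    have hlim' := hlim.tendsto
    rw [zero_mul, add_zero] at hlim'
    refine hlim'.congr' ?_
    filter_upwards [hS0] with s hs
    rw [← hconst s hs]
    ring

theorem exists_eq_linearComb_of_lagrangeForm_eq_zero {y z₁ z₂ : Fin 4 → ℝ}
    (h₁₂ : lagrangeForm κ z₁ z₂ = 0) (h₁ : lagrangeForm κ z₁ y = 0) (h₂ : lagrangeForm κ z₂ y = 0)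
    (hdet : z₁ 0 * z₂ 2 - z₂ 0 * z₁ 2 ≠ 0) : ∃ c₁ c₂ : ℝ, y = c₁ • z₁ + c₂ • z₂ := by
  have cramer : (z₁ 0 * z₂ 2 - z₂ 0 * z₁ 2) • y =
      (y 0 * z₂ 2 - z₂ 0 * y 2) • z₁ + (z₁ 0 * y 2 - y 0 * z₁ 2) • z₂ := by
    simp only [lagrangeForm] at h₁₂ h₁ h₂
    ext i
    simp only [Pi.smul_apply, Pi.add_apply, smul_eq_mul]
    fin_cases i <;> dsimp only [Fin.reduceFinMk]
    · ring
    · linear_combination z₂ 2 * h₁ - z₁ 2 * h₂ - y 2 * h₁₂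
    · ring
    · linear_combination z₂ 0 * h₁ - z₁ 0 * h₂ - y 0 * h₁₂
  exact ⟨_, _, by rw [← inv_smul_smul₀ hdet y, cramer, smul_add, smul_smul, smul_smul]⟩

theorem exists_eqOn_linearComb {S : Set ℝ} (hS : IsOpen S) (hSc : S.OrdConnected)
    (hSpos : S ⊆ Ioi 0) (hS0 : S ∈ 𝓝[>] 0) {y z₁ z₂ : ℝ → Fin 4 → ℝ}
    (hy : ∀ r ∈ S, HasDerivAt y (radialMatrix p q κ r *ᵥ y r) r)
    (hz₁ : ∀ r ∈ S, HasDerivAt z₁ (radialMatrix p q κ r *ᵥ z₁ r) r)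
    (hz₂ : ∀ r ∈ S, HasDerivAt z₂ (radialMatrix p q κ r *ᵥ z₂ r) r)
    (hy0 : ContinuousWithinAt (fun r => y r 0) (Ioi 0) 0)
    (hy2 : ContinuousWithinAt (fun r => y r 2) (Ioi 0) 0)
    (hz₁_reg : ContinuousWithinAt z₁ (Ioi 0) 0) (hz₂_reg : ContinuousWithinAt z₂ (Ioi 0) 0)
    {s : ℝ} (hs : s ∈ S) (hdet : z₁ s 0 * z₂ s 2 - z₂ s 0 * z₁ s 2 ≠ 0) :
    ∃ c₁ c₂ : ℝ, EqOn y (fun r => c₁ • z₁ r + c₂ • z₂ r) S := by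
  have hz₂_coord (i : Fin 4) := continuousWithinAt_pi.1 hz₂_reg i
  have hSp := hSc.isPreconnected
  obtain ⟨c₁, c₂, hc⟩ := exists_eq_linearComb_of_lagrangeForm_eq_zero
    (lagrangeForm_eq_zero hS hSp hSpos hS0 hz₁ hz₂ hz₁_reg (hz₂_coord 0) (hz₂_coord 2) hs)
    (lagrangeForm_eq_zero hS hSp hSpos hS0 hz₁ hy hz₁_reg hy0 hy2 hs)
    (lagrangeForm_eq_zero hS hSp hSpos hS0 hz₂ hy hz₂_reg hy0 hy2 hs) hdet
  refine ⟨c₁, c₂, eqOn_of_hasDerivAt_mulVec hSc (continuousOn_radialMatrix hSpos) hy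
    (fun r hr => ?_) hs hc⟩
  refine (((hz₁ r hr).const_smul c₁).fun_add ((hz₂ r hr).const_smul c₂)).congr_deriv ?_
  simp only [Matrix.mulVec_add, Matrix.mulVec_smul]

end RadialODE

section PairSolution

open scoped Matrix

variable {p q κ : ℝ} {I : Set ℝ} {A C u₁ v₁ u₂ v₂ : ℝ → ℝ}

/-- `(A, C)` solves on `I` the two-parameter coupled system
`r² A'' + r A' - A + p r² A + 2 κ r² C' = 0`, `C' + r C'' + q r C + 2 κ r A' + 2 κ A = 0`, in the
sense of `IsSolution` but without boundary conditions. The choice `κ = 0` decouples the equation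
for `B`. -/
structure IsPairSolution (p q κ : ℝ) (I : Set ℝ) (A C : ℝ → ℝ) : Prop where
  continuousOn_fst : ContinuousOn A I
  continuousOn_snd : ContinuousOn C I
  twiceDiff_fst : ∀ r ∈ interior I, TwiceDifferentiableAt A r
  twiceDiff_snd : ∀ r ∈ interior I, TwiceDifferentiableAt C r
  eq_fst : ∀ r ∈ interior I, r ^ 2 * deriv (deriv A) r + r * deriv A r - A r + p * r ^ 2 * A r
    + 2 * κ * r ^ 2 * deriv C r = 0
  eq_snd : ∀ r ∈ interior I, deriv C r + r * deriv (deriv C) r + q * r * C r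
    + 2 * κ * r * deriv A r + 2 * κ * A r = 0

theorem isPairSolution_zero (p q κ : ℝ) (I : Set ℝ) : IsPairSolution p q κ I 0 0 := by
  have twiceDiff (r : ℝ) : TwiceDifferentiableAt 0 r := ⟨by simp, by simp⟩
  exact ⟨continuousOn_const, continuousOn_const, fun r _ => twiceDiff r, fun r _ => twiceDiff r,
    by simp, by simp⟩

theorem IsPairSolution.hasDerivAt_cauchyData (h : IsPairSolution p q κ I A C) {r : ℝ}
    (hr : r ∈ interior I) (hr0 : r ≠ 0) :
    HasDerivAt (cauchyData A C) (radialMatrix p q κ r *ᵥ cauchyData A C r) r := by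
  refine hasDerivAt_radialMatrix_iff.2
    ⟨(h.twiceDiff_fst r hr).1.self_of_nhds.hasDerivAt,
      (h.twiceDiff_fst r hr).2.hasDerivAt.congr_deriv ?_,
      (h.twiceDiff_snd r hr).1.self_of_nhds.hasDerivAt,
      (h.twiceDiff_snd r hr).2.hasDerivAt.congr_deriv ?_⟩ <;>
    simp only [cauchyData, Matrix.cons_val] <;> field_simp
  · linear_combination h.eq_fst r hr
  · linear_combination h.eq_snd r hr

theorem continuous_cauchyData (hA : ContDiff ℝ 1 A) (hC : ContDiff ℝ 1 C) :
    Continuous (cauchyData A C) := by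
  have := hA.continuous_deriv le_rfl
  have := hC.continuous_deriv le_rfl
  have := hA.continuous
  have := hC.continuous
  refine continuous_pi fun i => ?_
  fin_cases i <;> assumption

theorem Ioo_zero_one_subset_interior (hI1 : Icc 0 1 ⊆ I) : Ioo (0 : ℝ) 1 ⊆ interior I :=
  isOpen_Ioo.subset_interior_iff.2 (Ioo_subset_Icc_self.trans hI1)

theorem interior_subset_Ioi_zero (hI0 : I ⊆ Ici 0) : interior I ⊆ Ioi (0 : ℝ) := by
  simpa using interior_mono hI0

theorem eqOn_of_eqOn_interior {X : Type*} [TopologicalSpace X] [T2Space X] {f g : ℝ → X}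
    (hI : I.OrdConnected) (hne : (interior I).Nonempty) (hf : ContinuousOn f I)
    (hg : ContinuousOn g I) (h : EqOn f g (interior I)) : EqOn f g I := by
  refine h.of_subset_closure hf hg interior_subset ?_
  rw [(hI.convex : Convex ℝ I).closure_interior_eq_closure_of_nonempty_interior hne]
  exact subset_closure

theorem IsPairSolution.exists_eqOn_linearComb (hI : I.OrdConnected) (hI1 : Icc 0 1 ⊆ I)
    (hI0 : I ⊆ Ici 0) (h : IsPairSolution p q κ I A C)
    (h₁ : IsPairSolution p q κ I u₁ v₁) (hu₁ : ContDiff ℝ 1 u₁) (hv₁ : ContDiff ℝ 1 v₁)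
    (h₂ : IsPairSolution p q κ I u₂ v₂) (hu₂ : ContDiff ℝ 1 u₂) (hv₂ : ContDiff ℝ 1 v₂)
    (hdet : u₁ 1 * v₂ 1 - u₂ 1 * v₁ 1 ≠ 0) :
    ∃ c₁ c₂ : ℝ, EqOn A (fun r => c₁ * u₁ r + c₂ * u₂ r) I ∧
      EqOn C (fun r => c₁ * v₁ r + c₂ * v₂ r) I := by
  have hpos := interior_subset_Ioi_zero hI0
  have hIoo := Ioo_zero_one_subset_interior hI1
  have hne : (interior I).Nonempty := (nonempty_Ioo.2 zero_lt_one).mono hIoo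
  have cu₁ := hu₁.continuous
  have cv₁ := hv₁.continuous
  have cu₂ := hu₂.continuous
  have cv₂ := hv₂.continuous
  obtain ⟨s, hs, hdet_s⟩ : ∃ s ∈ interior I, u₁ s * v₂ s - u₂ s * v₁ s ≠ 0 := by
    have near : ∀ᶠ s in 𝓝[<] (1 : ℝ), u₁ s * v₂ s - u₂ s * v₁ s ≠ 0 :=
      nhdsWithin_le_nhds ((by fun_prop : Continuous fun s => u₁ s * v₂ s - u₂ s * v₁ s)
        |>.continuousAt.eventually_ne hdet)
    obtain ⟨s, hs, hs01⟩ := (near.and (Ioo_mem_nhdsLT zero_lt_one)).exists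
    exact ⟨s, hIoo hs01, hs⟩
  have continuousWithinAt_zero {f : ℝ → ℝ} (hf : ContinuousOn f I) :
      ContinuousWithinAt f (Ioi 0) 0 :=
    ((hf.mono hI1) 0 (by simp)).mono_of_mem_nhdsWithin (Icc_mem_nhdsGT zero_lt_one)
  obtain ⟨c₁, c₂, hc⟩ := RadialSystem.exists_eqOn_linearComb isOpen_interior hI.interior hpos
    (mem_of_superset (Ioo_mem_nhdsGT zero_lt_one) hIoo)
    (fun r hr => h.hasDerivAt_cauchyData hr (hpos hr).ne')
    (fun r hr => h₁.hasDerivAt_cauchyData hr (hpos hr).ne')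
    (fun r hr => h₂.hasDerivAt_cauchyData hr (hpos hr).ne')
    (continuousWithinAt_zero h.continuousOn_fst) (continuousWithinAt_zero h.continuousOn_snd)
    (continuous_cauchyData hu₁ hv₁).continuousWithinAt
    (continuous_cauchyData hu₂ hv₂).continuousWithinAt hs hdet_s
  refine ⟨c₁, c₂, eqOn_of_eqOn_interior hI hne h.continuousOn_fst ?_ fun r hr => ?_,
    eqOn_of_eqOn_interior hI hne h.continuousOn_snd ?_ fun r hr => ?_⟩
  · fun_prop
  · exact congrFun (hc hr) 0
  · fun_prop
  · exact congrFun (hc hr) 2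

theorem IsPairSolution.eqOn_of_eq_at_one {A' C' : ℝ → ℝ} (hI : I.OrdConnected)
    (hI1 : Icc 0 1 ⊆ I) (hI0 : I ⊆ Ici 0)
    (h₁ : IsPairSolution p q κ I u₁ v₁) (hu₁ : ContDiff ℝ 1 u₁) (hv₁ : ContDiff ℝ 1 v₁)
    (h₂ : IsPairSolution p q κ I u₂ v₂) (hu₂ : ContDiff ℝ 1 u₂) (hv₂ : ContDiff ℝ 1 v₂)
    (hdet : u₁ 1 * v₂ 1 - u₂ 1 * v₁ 1 ≠ 0) (h : IsPairSolution p q κ I A C)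
    (h' : IsPairSolution p q κ I A' C') (hA : A 1 = A' 1) (hC : C 1 = C' 1) :
    EqOn A A' I ∧ EqOn C C' I := by
  have h1I : (1 : ℝ) ∈ I := hI1 (by simp)
  obtain ⟨c₁, c₂, hAc, hCc⟩ :=
    h.exists_eqOn_linearComb hI hI1 hI0 h₁ hu₁ hv₁ h₂ hu₂ hv₂ hdet
  obtain ⟨c₁', c₂', hAc', hCc'⟩ :=
    h'.exists_eqOn_linearComb hI hI1 hI0 h₁ hu₁ hv₁ h₂ hu₂ hv₂ hdet
  have eqA : c₁ * u₁ 1 + c₂ * u₂ 1 = c₁' * u₁ 1 + c₂' * u₂ 1 :=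
    (hAc h1I).symm.trans (hA.trans (hAc' h1I))
  have eqC : c₁ * v₁ 1 + c₂ * v₂ 1 = c₁' * v₁ 1 + c₂' * v₂ 1 :=
    (hCc h1I).symm.trans (hC.trans (hCc' h1I))
  obtain rfl : c₁ = c₁' := mul_right_cancel₀ hdet (by linear_combination v₂ 1 * eqA - u₂ 1 * eqC)
  obtain rfl : c₂ = c₂' := mul_right_cancel₀ hdet (by linear_combination u₁ 1 * eqC - v₁ 1 * eqA)
  exact ⟨hAc.trans hAc'.symm, hCc.trans hCc'.symm⟩

end PairSolution

section Bessel

open scoped Nat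

/-- The `k`-th term of the power series of `J_n`. -/
noncomputable def besselTerm (n k : ℕ) (z : ℂ) : ℂ :=
  (-1 : ℂ) ^ k / ((k ! : ℂ) * ((k + n)! : ℂ)) * (z / 2) ^ (2 * k + n)

theorem hasSum_besselTerm (n : ℕ) (z : ℂ) :
    HasSum (fun k => besselTerm n k z) (besselJ n z) :=
  (summable_besselJ n z).hasSum

theorem differentiable_besselTerm (n k : ℕ) : Differentiable ℂ (besselTerm n k) := by
  unfold besselTerm
  fun_prop

theorem mul_deriv_besselTerm (n k : ℕ) (z : ℂ) :
    z * deriv (besselTerm n k) z = (2 * k + n) * besselTerm n k z := by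
  have h : HasDerivAt (besselTerm n k) _ z :=
    (((hasDerivAt_id z).div_const 2).pow (2 * k + n)).const_mul _
  rw [h.deriv, besselTerm]
  rcases hm : 2 * k + n with - | m
  · have : (2 * k + n : ℂ) = 0 := by exact_mod_cast hm
    simp [this]
  · have : (2 * k + n : ℂ) = m + 1 := by exact_mod_cast hm
    simp only [this, Nat.add_sub_cancel, id]
    push_cast
    ring

theorem two_mul_succ_mul_besselTerm_succ (n k : ℕ) (z : ℂ) :
    2 * (k + 1) * besselTerm n (k + 1) z = -(z * besselTerm (n + 1) k z) := by
  have hk : (k ! : ℂ) ≠ 0 := by exact_mod_cast k.factorial_ne_zero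
  have hkn : ((k + (n + 1))! : ℂ) ≠ 0 := by exact_mod_cast Nat.factorial_ne_zero _
  have hk1 : (k : ℂ) + 1 ≠ 0 := by exact_mod_cast k.succ_ne_zero
  rw [besselTerm, besselTerm, add_right_comm k 1 n, add_assoc k n 1, Nat.factorial_succ k]
  push_cast
  field_simp
  ring

theorem two_mul_add_succ_mul_besselTerm (n k : ℕ) (z : ℂ) :
    2 * (k + n + 1) * besselTerm (n + 1) k z = z * besselTerm n k z := by
  have hk : (k ! : ℂ) ≠ 0 := by exact_mod_cast k.factorial_ne_zero
  have hkn : ((k + n)! : ℂ) ≠ 0 := by exact_mod_cast Nat.factorial_ne_zero _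
  have hk1 : (k : ℂ) + n + 1 ≠ 0 := by exact_mod_cast (k + n).succ_ne_zero
  rw [besselTerm, besselTerm, ← add_assoc k n 1, Nat.factorial_succ (k + n)]
  push_cast
  field_simp
  ring

theorem norm_besselTerm_le {n k : ℕ} {w : ℂ} {R : ℝ} (hw : ‖w‖ ≤ R) :
    ‖besselTerm n k w‖ ≤ ‖besselTerm n k R‖ := by
  have hwR : ‖w‖ ≤ ‖(R : ℂ)‖ := by
    rw [Complex.norm_real]
    exact hw.trans (le_abs_self R)
  simp only [besselTerm, norm_mul, norm_pow, norm_div]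
  gcongr

theorem differentiable_besselJ (n : ℕ) : Differentiable ℂ (besselJ n) := fun z =>
  (Complex.differentiableOn_tsum_of_summable_norm (summable_besselJ n ((‖z‖ + 1 : ℝ) : ℂ)).norm
    (fun k => (differentiable_besselTerm n k).differentiableOn) Metric.isOpen_ball
    fun _ _ hw => norm_besselTerm_le (mem_ball_zero_iff.1 hw).le).differentiableAt
    (Metric.isOpen_ball.mem_nhds (by simp))

theorem hasSum_deriv_besselTerm (n : ℕ) (z : ℂ) :
    HasSum (fun k => deriv (besselTerm n k) z) (deriv (besselJ n) z) :=
  Complex.hasSum_deriv_of_summable_norm (summable_besselJ n ((‖z‖ + 1 : ℝ) : ℂ)).norm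
    (fun k => (differentiable_besselTerm n k).differentiableOn) Metric.isOpen_ball
    (fun _ _ hw => norm_besselTerm_le (mem_ball_zero_iff.1 hw).le) (by simp)

theorem hasSum_mul_deriv_besselJ (n : ℕ) (z : ℂ) :
    HasSum (fun k : ℕ => (2 * k + n) * besselTerm n k z) (z * deriv (besselJ n) z) := by
  simpa only [mul_deriv_besselTerm] using (hasSum_deriv_besselTerm n z).mul_left z

theorem mul_deriv_besselJ (n : ℕ) (z : ℂ) :
    z * deriv (besselJ n) z = n * besselJ n z - z * besselJ (n + 1) z := by
  have hdiff : HasSum (fun k : ℕ => 2 * k * besselTerm n k z)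
      (z * deriv (besselJ n) z - n * besselJ n z) := by
    simpa only [← sub_mul, add_sub_cancel_right] using
      (hasSum_mul_deriv_besselJ n z).sub ((hasSum_besselTerm n z).mul_left (n : ℂ))
  have hshift : HasSum (fun k : ℕ => 2 * ((k + 1 : ℕ) : ℂ) * besselTerm n (k + 1) z)
      (-(z * besselJ (n + 1) z)) := by
    simpa only [Nat.cast_succ, two_mul_succ_mul_besselTerm_succ] using
      ((hasSum_besselTerm (n + 1) z).mul_left z).neg
  have := hdiff.unique (hasSum_nat_add_iff 1 |>.1 hshift)
  simp only [Finset.range_one, Finset.sum_singleton, Nat.cast_zero, mul_zero, zero_mul,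
    add_zero] at this
  linear_combination this

theorem mul_deriv_besselJ_succ (n : ℕ) (z : ℂ) :
    z * deriv (besselJ (n + 1)) z = z * besselJ n z - (n + 1) * besselJ (n + 1) z := by
  have hsum := (hasSum_mul_deriv_besselJ (n + 1) z).add
    ((hasSum_besselTerm (n + 1) z).mul_left (n + 1 : ℂ))
  rw [eq_sub_iff_add_eq]
  refine hsum.unique (((hasSum_besselTerm n z).mul_left z).congr_fun fun k => ?_)
  rw [← two_mul_add_succ_mul_besselTerm]
  push_cast
  ring

theorem deriv_besselJ_add_mul_deriv_deriv (n : ℕ) (z : ℂ) :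
    deriv (besselJ n) z + z * deriv (deriv (besselJ n)) z =
      n * deriv (besselJ n) z - (besselJ (n + 1) z + z * deriv (besselJ (n + 1)) z) := by
  have hn := (differentiable_besselJ n z).hasDerivAt
  have hn' := ((differentiable_besselJ n).deriv z).hasDerivAt
  have hsucc := (differentiable_besselJ (n + 1) z).hasDerivAt
  have hleft := (hasDerivAt_id z).fun_mul hn'
  have hright := (hn.const_mul (n : ℂ)).fun_sub ((hasDerivAt_id z).fun_mul hsucc)
  simpa only [id, one_mul] using
    hleft.unique (hright.congr_of_eventuallyEq (.of_forall (mul_deriv_besselJ n)))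

theorem bessel_equation (n : ℕ) (z : ℂ) :
    z ^ 2 * deriv (deriv (besselJ n)) z + z * deriv (besselJ n) z
      + (z ^ 2 - n ^ 2) * besselJ n z = 0 := by
  linear_combination z * deriv_besselJ_add_mul_deriv_deriv n z + n * mul_deriv_besselJ n z
    - z * mul_deriv_besselJ_succ n z

theorem deriv_besselJ_zero (z : ℂ) : deriv (besselJ 0) z = -besselJ 1 z := by
  rcases eq_or_ne z 0 with rfl | hz
  · simpa using deriv_besselJ_add_mul_deriv_deriv 0 0
  · exact mul_left_cancel₀ hz (by simpa using mul_deriv_besselJ 0 z)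

theorem besselJ_zero_zero : besselJ 0 0 = 1 := by
  refine (hasSum_besselTerm 0 0).unique ?_
  simpa [besselTerm] using hasSum_single 0 fun k hk => show besselTerm 0 k 0 = 0 by
    simp [besselTerm, hk]

theorem besselJ_succ_zero (n : ℕ) : besselJ (n + 1) 0 = 0 := by
  have h : (n + 1 : ℂ) * besselJ (n + 1) 0 = 0 := by simpa using mul_deriv_besselJ_succ n 0
  exact (mul_eq_zero.1 h).resolve_left n.cast_add_one_ne_zero

theorem besselJ_neg (n : ℕ) (z : ℂ) : besselJ n (-z) = (-1) ^ n * besselJ n z := by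
  unfold besselJ
  rw [← tsum_mul_left]
  refine tsum_congr fun k => ?_
  rw [neg_div, neg_pow (z / 2), pow_add, pow_mul, neg_one_sq, one_pow, one_mul]
  ring

theorem conj_besselJ (n : ℕ) (z : ℂ) :
    starRingEnd ℂ (besselJ n z) = besselJ n (starRingEnd ℂ z) := by
  unfold besselJ
  rw [Complex.conj_tsum]
  exact tsum_congr fun k => by simp [Complex.conj_ofNat]

theorem im_besselJ_ofReal (n : ℕ) (x : ℝ) : (besselJ n x).im = 0 :=
  Complex.conj_eq_iff_im.1 (by rw [conj_besselJ, Complex.conj_ofReal])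

end Bessel

section ImScale

/-- The real function `r ↦ Im (a g(μ r))`. The real and imaginary parts of the complex-scaled Bessel
functions from which all solutions are built have this shape. -/
noncomputable def imScale (g : ℂ → ℂ) (a μ : ℂ) (r : ℝ) : ℝ := (a * g (μ * r)).im

variable {g : ℂ → ℂ}

theorem hasDerivAt_imScale (hg : Differentiable ℂ g) (a μ : ℂ) (r : ℝ) :
    HasDerivAt (imScale g a μ) (imScale (deriv g) (a * μ) μ r) r := by
  have complexDeriv : HasDerivAt (fun z : ℂ => a * g (μ * z)) (a * μ * deriv g (μ * r)) (r : ℂ) :=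
    (((hg (μ * r)).hasDerivAt.comp (r : ℂ)
      ((hasDerivAt_id (r : ℂ)).const_mul μ)).const_mul a).congr_deriv (by ring)
  exact Complex.imCLM.hasFDerivAt.comp_hasDerivAt r complexDeriv.comp_ofReal

theorem deriv_imScale (hg : Differentiable ℂ g) (a μ : ℂ) :
    deriv (imScale g a μ) = imScale (deriv g) (a * μ) μ :=
  funext fun r => (hasDerivAt_imScale hg a μ r).deriv

theorem contDiff_imScale (hg : Differentiable ℂ g) (a μ : ℂ) {n : WithTop ℕ∞} :
    ContDiff ℝ n (imScale g a μ) := by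
  have complexSmooth : ContDiff ℂ n fun z : ℂ => a * g (μ * z) :=
    contDiff_const.mul (hg.contDiff.comp (contDiff_const.mul contDiff_id))
  exact Complex.imCLM.contDiff.comp
    ((complexSmooth.restrict_scalars ℝ).comp Complex.ofRealCLM.contDiff)

theorem twiceDifferentiableAt_imScale (hg : Differentiable ℂ g) (a μ : ℂ) (r : ℝ) :
    TwiceDifferentiableAt (imScale g a μ) r := by
  refine ⟨.of_forall fun s => (hasDerivAt_imScale hg a μ s).differentiableAt, ?_⟩
  rw [deriv_imScale hg]
  exact (hasDerivAt_imScale hg.deriv _ μ r).differentiableAt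

theorem imScale_one (g : ℂ → ℂ) (a μ : ℂ) : imScale g a μ 1 = (a * g μ).im := by
  simp [imScale]

theorem isPairSolution_imScale_besselJ {p q κ : ℝ} {a b μ : ℂ}
    (hfst : (p - μ ^ 2) * a = 2 * κ * μ * b) (hsnd : (q - μ ^ 2) * b + 2 * κ * μ * a = 0)
    (I : Set ℝ) :
    IsPairSolution p q κ I (imScale (besselJ 1) a μ) (imScale (besselJ 0) b μ) := by
  have d0 := differentiable_besselJ 0
  have d1 := differentiable_besselJ 1
  refine ⟨(contDiff_imScale d1 a μ (n := 0)).continuous.continuousOn,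
    (contDiff_imScale d0 b μ (n := 0)).continuous.continuousOn,
    fun r _ => twiceDifferentiableAt_imScale d1 a μ r,
    fun r _ => twiceDifferentiableAt_imScale d0 b μ r, fun r _ => ?_, fun r _ => ?_⟩
  · rw [deriv_imScale d1, deriv_imScale d1.deriv, deriv_imScale d0]
    have complexEq : (r ^ 2 : ℝ) * (a * μ * μ * deriv (deriv (besselJ 1)) (μ * r))
        + r * (a * μ * deriv (besselJ 1) (μ * r)) - a * besselJ 1 (μ * r)
        + (p * r ^ 2 : ℝ) * (a * besselJ 1 (μ * r))
        + (2 * κ * r ^ 2 : ℝ) * (b * μ * deriv (besselJ 0) (μ * r)) = 0 := by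
      have bessel := bessel_equation 1 (μ * r)
      rw [deriv_besselJ_zero]
      push_cast at bessel ⊢
      linear_combination a * bessel + r ^ 2 * besselJ 1 (μ * r) * hfst
    simpa only [imScale, Complex.add_im, Complex.sub_im, Complex.im_ofReal_mul, Complex.zero_im]
      using congrArg Complex.im complexEq
  · rw [deriv_imScale d1, deriv_imScale d0, deriv_imScale d0.deriv]
    have complexEq : b * μ * deriv (besselJ 0) (μ * r)
        + r * (b * μ * μ * deriv (deriv (besselJ 0)) (μ * r))
        + (q * r : ℝ) * (b * besselJ 0 (μ * r))
        + (2 * κ * r : ℝ) * (a * μ * deriv (besselJ 1) (μ * r))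
        + (2 * κ : ℝ) * (a * besselJ 1 (μ * r)) = 0 := by
      have raising := mul_deriv_besselJ_succ 0 (μ * r)
      have deriv_deriv := deriv_besselJ_add_mul_deriv_deriv 0 (μ * r)
      push_cast at raising deriv_deriv ⊢
      linear_combination b * μ * deriv_deriv + (2 * κ * a - b * μ) * raising
        + r * besselJ 0 (μ * r) * hsnd
    simpa only [imScale, Complex.add_im, Complex.im_ofReal_mul, Complex.zero_im]
      using congrArg Complex.im complexEq

theorem IsPairSolution.eqOn_zero_of_decoupled {lam : ℝ} {I : Set ℝ} {B : ℝ → ℝ}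
    (h : IsPairSolution (lam ^ 2) 0 0 I B 0) (hI : I.OrdConnected) (hI1 : Icc 0 1 ⊆ I)
    (hI0 : I ⊆ Ici 0) (hJ : besselJ 1 lam ≠ 0) (hB : B 1 = 0) : EqOn B 0 I := by
  have d0 := differentiable_besselJ 0
  have d1 := differentiable_besselJ 1
  refine (IsPairSolution.eqOn_of_eq_at_one hI hI1 hI0
    (isPairSolution_imScale_besselJ (a := Complex.I) (b := 0) (μ := lam) (by simp) (by simp) I)
    (contDiff_imScale d1 _ _) (contDiff_imScale d0 _ _)
    (isPairSolution_imScale_besselJ (a := 0) (b := Complex.I) (μ := 0) (by simp) (by simp) I)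
    (contDiff_imScale d1 _ _) (contDiff_imScale d0 _ _) ?_ h (isPairSolution_zero _ _ _ I)
    hB rfl).1
  have hre : (besselJ 1 lam).re ≠ 0 := fun h0 => hJ (Complex.ext h0 (im_besselJ_ofReal 1 lam))
  simpa [imScale_one, besselJ_zero_zero] using hre

end ImScale

section Solution

variable {ζ : ℂ} {lam : ℝ}

theorem pow_four_add_sq_add_two (hζ : ζ ^ 2 = (-1 + Complex.I * (√7 : ℝ)) / 2) :
    ζ ^ 4 + ζ ^ 2 + 2 = 0 := by
  have h7 : ((√7 : ℝ) : ℂ) ^ 2 = 7 := by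
    exact_mod_cast Real.sq_sqrt (by norm_num : (0 : ℝ) ≤ 7)
  have : ζ ^ 4 = (ζ ^ 2) ^ 2 := by ring
  rw [this, hζ]
  linear_combination (Complex.I ^ 2 / 4) * h7 + 7 / 4 * Complex.I_sq

theorem mul_conj_eq_sqrt_two (hζ : ζ ^ 2 = (-1 + Complex.I * (√7 : ℝ)) / 2) :
    ζ * starRingEnd ℂ ζ = (√2 : ℝ) := by
  have h7 : √7 * √7 = 7 := Real.mul_self_sqrt (by norm_num)
  have normSq_sq : Complex.normSq ζ ^ 2 = 2 := by
    rw [← map_pow, hζ, Complex.normSq_apply]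
    norm_num
    linear_combination h7 / 4
  rw [Complex.mul_conj, ← normSq_sq, Real.sqrt_sq (Complex.normSq_nonneg ζ)]

theorem two_mul_mul_conj_alpha (hζ : ζ ^ 2 = (-1 + Complex.I * (√7 : ℝ)) / 2) :
    2 * ζ * starRingEnd ℂ (alpha ζ) = (√2 : ℝ) * (1 - ζ ^ 2) := by
  have conj_sq : starRingEnd ℂ ζ ^ 2 = -1 - ζ ^ 2 := by
    rw [← map_pow, hζ]
    simp only [map_div₀, map_add, map_neg, map_one, map_mul, Complex.conj_I, Complex.conj_ofReal,
      Complex.conj_ofNat]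
    ring
  simp only [alpha, map_add, map_div₀, map_pow, Complex.conj_ofNat]
  linear_combination
    ζ * starRingEnd ℂ ζ * conj_sq + (1 - ζ ^ 2) * mul_conj_eq_sqrt_two hζ

theorem two_sub_sq_mul_conj_alpha (hζ : ζ ^ 2 = (-1 + Complex.I * (√7 : ℝ)) / 2) :
    (2 - ζ ^ 2) * starRingEnd ℂ (alpha ζ) + 2 * ζ * (√2 : ℝ) = 0 := by
  have hζ4 := pow_four_add_sq_add_two hζ
  have hζ0 : ζ ≠ 0 := by
    rintro rfl
    norm_num at hζ4
  refine mul_left_cancel₀ (mul_ne_zero two_ne_zero hζ0) ?_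
  linear_combination (2 - ζ ^ 2) * two_mul_mul_conj_alpha hζ + (√2 : ℝ) * hζ4

theorem isPairSolution_imScale_sqrt_two_conj_alpha
    (hζ : ζ ^ 2 = (-1 + Complex.I * (√7 : ℝ)) / 2) (lam : ℝ) (c : ℂ) (I : Set ℝ) :
    IsPairSolution (lam ^ 2) (2 * lam ^ 2) lam I
      (imScale (besselJ 1) (c * (√2 : ℝ)) (lam * ζ))
      (imScale (besselJ 0) (c * starRingEnd ℂ (alpha ζ)) (lam * ζ)) := by
  refine isPairSolution_imScale_besselJ ?_ ?_ I <;> push_cast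
  · linear_combination -(c * lam ^ 2) * two_mul_mul_conj_alpha hζ
  · linear_combination c * lam ^ 2 * two_sub_sq_mul_conj_alpha hζ

theorem solA_eq_imScale (ζ : ℂ) (lam : ℝ) : solA ζ lam = imScale (besselJ 1)
    (besselJ 1 (lam * starRingEnd ℂ ζ) / d ζ lam * (√2 : ℝ)) (lam * ζ) := by
  funext r
  rw [solA, imScale, ← Complex.im_ofReal_mul]
  congr 1
  push_cast
  ring

theorem solC_eq_imScale (ζ : ℂ) (lam : ℝ) : solC ζ lam = imScale (besselJ 0)
    (besselJ 1 (lam * starRingEnd ℂ ζ) / d ζ lam * starRingEnd ℂ (alpha ζ)) (lam * ζ) := by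
  funext r
  rw [solC, imScale, ← Complex.im_ofReal_mul]
  congr 1
  push_cast
  ring

theorem contDiff_solA (ζ : ℂ) (lam : ℝ) : ContDiff ℝ (⊤ : ℕ∞) (solA ζ lam) := by
  rw [solA_eq_imScale]
  exact contDiff_imScale (differentiable_besselJ 1) _ _

theorem contDiff_solC (ζ : ℂ) (lam : ℝ) : ContDiff ℝ (⊤ : ℕ∞) (solC ζ lam) := by
  rw [solC_eq_imScale]
  exact contDiff_imScale (differentiable_besselJ 0) _ _

theorem alpha_neg (ζ : ℂ) : alpha (-ζ) = -alpha ζ := by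
  unfold alpha
  ring

theorem d_neg (ζ : ℂ) (lam : ℝ) : d (-ζ) lam = d ζ lam := by
  simp [d, alpha_neg, besselJ_neg]

theorem solA_neg (ζ : ℂ) (lam : ℝ) : solA (-ζ) lam = solA ζ lam := by
  funext r
  simp [solA, d_neg, besselJ_neg]

theorem solC_neg (ζ : ℂ) (lam : ℝ) : solC (-ζ) lam = solC ζ lam := by
  funext r
  simp [solC, d_neg, alpha_neg, besselJ_neg]

theorem conj_besselJ_ofReal_mul (n : ℕ) (lam : ℝ) (ζ : ℂ) :
    starRingEnd ℂ (besselJ n (lam * ζ)) = besselJ n (lam * starRingEnd ℂ ζ) := by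
  rw [conj_besselJ, map_mul, Complex.conj_ofReal]

theorem solA_one (ζ : ℂ) (lam : ℝ) : solA ζ lam 1 = 0 := by
  rw [solA, Complex.ofReal_one, mul_one, ← conj_besselJ_ofReal_mul, mul_comm (starRingEnd ℂ _),
    Complex.mul_conj, Complex.ofReal_im, mul_zero]

theorem solA_zero (ζ : ℂ) (lam : ℝ) : solA ζ lam 0 = 0 := by
  simp [solA, besselJ_succ_zero]

theorem solC_one (hd : d ζ lam ≠ 0) : solC ζ lam 1 = 1 := by
  rw [solC, Complex.ofReal_one, mul_one, mul_right_comm, one_div]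
  exact inv_mul_cancel₀ hd

theorem hasDerivAt_solC_zero (ζ : ℂ) (lam : ℝ) : HasDerivAt (solC ζ lam) 0 0 := by
  rw [solC_eq_imScale]
  refine (hasDerivAt_imScale (differentiable_besselJ 0) _ _ 0).congr_deriv ?_
  simp [imScale, deriv_besselJ_zero, besselJ_succ_zero]

theorem isPairSolution_sol (hζ : ζ ^ 2 = (-1 + Complex.I * (√7 : ℝ)) / 2) (lam : ℝ) (I : Set ℝ) :
    IsPairSolution (lam ^ 2) (2 * lam ^ 2) lam I (solA ζ lam) (solC ζ lam) := by
  rw [solA_eq_imScale, solC_eq_imScale]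
  exact isPairSolution_imScale_sqrt_two_conj_alpha hζ lam _ I

theorem isSolution_iff {I : Set ℝ} {A B C : ℝ → ℝ} :
    IsSolution lam I A B C ↔
      IsPairSolution (lam ^ 2) (2 * lam ^ 2) lam I A C ∧ IsPairSolution (lam ^ 2) 0 0 I B 0 ∧
      (A 0 = 0 ∧ B 0 = 0 ∧ HasDerivWithinAt C 0 I 0) ∧ A 1 = 0 ∧ B 1 = 0 ∧ C 1 = 1 := by
  have hzero := isPairSolution_zero (lam ^ 2) 0 0 I
  constructor
  · intro h
    exact ⟨⟨h.continuousOn_A, h.continuousOn_C, h.twiceDiff_A, h.twiceDiff_C, h.eq_A, h.eq_C⟩,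
      ⟨h.continuousOn_B, hzero.continuousOn_snd, h.twiceDiff_B, hzero.twiceDiff_snd,
        fun r hr => by linear_combination h.eq_B r hr, fun r _ => by simp⟩,
      ⟨h.A_zero, h.B_zero, h.deriv_C_zero⟩, h.A_one, h.B_one, h.C_one⟩
  · rintro ⟨hAC, hB, ⟨hA0, hB0, hC0⟩, hA1, hB1, hC1⟩
    exact ⟨hAC.continuousOn_fst, hB.continuousOn_fst, hAC.continuousOn_snd, hAC.twiceDiff_fst,
      hB.twiceDiff_fst, hAC.twiceDiff_snd, hAC.eq_fst,
      fun r hr => by linear_combination hB.eq_fst r hr, hAC.eq_snd,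
      hA0, hB0, hC0, hA1, hB1, hC1⟩

theorem isSolution_sol (hζ : ζ ^ 2 = (-1 + Complex.I * (√7 : ℝ)) / 2) (hd : d ζ lam ≠ 0)
    (I : Set ℝ) : IsSolution lam I (solA ζ lam) (fun _ => 0) (solC ζ lam) :=
  isSolution_iff.2 ⟨isPairSolution_sol hζ lam I, isPairSolution_zero _ _ _ I,
    ⟨solA_zero ζ lam, rfl, (hasDerivAt_solC_zero ζ lam).hasDerivWithinAt⟩,
    solA_one ζ lam, rfl, solC_one hd⟩

theorem im_mul_im_I_mul_sub (x y : ℂ) :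
    x.im * (Complex.I * y).im - (Complex.I * x).im * y.im = -(y * starRingEnd ℂ x).im := by
  simp only [Complex.mul_im, Complex.I_re, Complex.I_im, Complex.conj_re, Complex.conj_im]
  ring

theorem IsPairSolution.eqOn_sol {I : Set ℝ} {A C : ℝ → ℝ}
    (h : IsPairSolution (lam ^ 2) (2 * lam ^ 2) lam I A C)
    (hζ : ζ ^ 2 = (-1 + Complex.I * (√7 : ℝ)) / 2) (hd : d ζ lam ≠ 0) (hI : I.OrdConnected)
    (hI1 : Icc 0 1 ⊆ I) (hI0 : I ⊆ Ici 0) (hA : A 1 = 0) (hC : C 1 = 1) :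
    EqOn A (solA ζ lam) I ∧ EqOn C (solC ζ lam) I := by
  have d0 := differentiable_besselJ 0
  have d1 := differentiable_besselJ 1
  refine IsPairSolution.eqOn_of_eq_at_one hI hI1 hI0
    (isPairSolution_imScale_sqrt_two_conj_alpha hζ lam 1 I)
    (contDiff_imScale d1 _ _) (contDiff_imScale d0 _ _)
    (isPairSolution_imScale_sqrt_two_conj_alpha hζ lam Complex.I I)
    (contDiff_imScale d1 _ _) (contDiff_imScale d0 _ _) ?_ h (isPairSolution_sol hζ lam I)
    (hA.trans (solA_one ζ lam).symm) (hC.trans (solC_one hd).symm)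
  have det_eq : starRingEnd ℂ (alpha ζ) * besselJ 0 (lam * ζ) *
      starRingEnd ℂ ((√2 : ℝ) * besselJ 1 (lam * ζ)) =
      (√2 : ℝ) * (starRingEnd ℂ (alpha ζ) * besselJ 0 (lam * ζ) *
        besselJ 1 (lam * starRingEnd ℂ ζ)) := by
    rw [map_mul, Complex.conj_ofReal, conj_besselJ_ofReal_mul]
    ring
  simp only [imScale_one, one_mul, mul_assoc Complex.I]
  rw [im_mul_im_I_mul_sub, det_eq, Complex.im_ofReal_mul]
  exact neg_ne_zero.2 (mul_ne_zero (Real.sqrt_pos.2 two_pos).ne' hd)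

end Solution

end RadialSystem

theorem mainTheorem2_general (ζ : ℂ) (hζ : ζ ^ 2 = (-1 + Complex.I * (√7 : ℝ)) / 2) (lam : ℝ)
    (hd : RadialSystem.d ζ lam ≠ 0) (hJ : RadialSystem.besselJ 1 lam ≠ 0) :
    (ContDiff ℝ (⊤ : ℕ∞) (RadialSystem.solA ζ lam) ∧
      ContDiff ℝ (⊤ : ℕ∞) (RadialSystem.solC ζ lam)) ∧
    (RadialSystem.solA (-ζ) lam = RadialSystem.solA ζ lam ∧
      RadialSystem.solC (-ζ) lam = RadialSystem.solC ζ lam) ∧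
    ∀ I : Set ℝ, I.OrdConnected → Set.Icc 0 1 ⊆ I → I ⊆ Set.Ici 0 →
      RadialSystem.IsSolution lam I
        (RadialSystem.solA ζ lam) (fun _ => 0) (RadialSystem.solC ζ lam) ∧
      ∀ A B C : ℝ → ℝ, RadialSystem.IsPairSolution (lam ^ 2) (2 * lam ^ 2) lam I A C →
        RadialSystem.IsPairSolution (lam ^ 2) 0 0 I B 0 → A 1 = 0 → B 1 = 0 → C 1 = 1 →
        Set.EqOn A (RadialSystem.solA ζ lam) I ∧
        Set.EqOn B (fun _ => 0) I ∧
        Set.EqOn C (RadialSystem.solC ζ lam) I := by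
  refine ⟨⟨RadialSystem.contDiff_solA ζ lam, RadialSystem.contDiff_solC ζ lam⟩,
    ⟨RadialSystem.solA_neg ζ lam, RadialSystem.solC_neg ζ lam⟩, fun I hI hI1 hI0 =>
    ⟨RadialSystem.isSolution_sol hζ hd I, fun A B C hAC hB hA1 hB1 hC1 => ?_⟩⟩
  obtain ⟨hA, hC⟩ := hAC.eqOn_sol hζ hd hI hI1 hI0 hA1 hC1
  exact ⟨hA, hB.eqOn_zero_of_decoupled hI hI1 hI0 hJ hB1, hC⟩

theorem mainTheorem2 (ζ : ℂ) (hζ : ζ ^ 2 = (-1 + Complex.I * (√7 : ℝ)) / 2)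
    (lam : ℝ) (hlam : 0 < lam)
    (hd : (RadialSystem.d ζ lam : ℂ) * RadialSystem.besselJ 1 (lam : ℂ) ≠ 0) :
    (ContDiff ℝ (⊤ : ℕ∞) (RadialSystem.solA ζ lam) ∧
      ContDiff ℝ (⊤ : ℕ∞) (RadialSystem.solC ζ lam)) ∧
    (RadialSystem.solA (-ζ) lam = RadialSystem.solA ζ lam ∧
      RadialSystem.solC (-ζ) lam = RadialSystem.solC ζ lam) ∧
    ∀ I : Set ℝ, I.OrdConnected → Set.Icc 0 1 ⊆ I → I ⊆ Set.Ici 0 →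
      RadialSystem.IsSolution lam I
        (RadialSystem.solA ζ lam) (fun _ => 0) (RadialSystem.solC ζ lam) ∧
      ∀ A B C : ℝ → ℝ, RadialSystem.IsSolution lam I A B C →
        Set.EqOn A (RadialSystem.solA ζ lam) I ∧
        Set.EqOn B (fun _ => 0) I ∧
        Set.EqOn C (RadialSystem.solC ζ lam) I := by
  obtain ⟨hsmooth, hneg, hsol⟩ := mainTheorem2_general ζ hζ lam
    (by exact_mod_cast left_ne_zero_of_mul hd) (right_ne_zero_of_mul hd)
  refine ⟨hsmooth, hneg, fun I hI hI1 hI0 => (hsol I hI hI1 hI0).imp_right fun huniq A B C h => ?_⟩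
  obtain ⟨hAC, hB, -, hA1, hB1, hC1⟩ := RadialSystem.isSolution_iff.1 h
  exact huniq A B C hAC hB hA1 hB1 hC1
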